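/- A quantum relative entropy is a function $\mathbb D(\rho\|\sigma)\in\mathbb R\cup\{+\infty\}$, defined for all pairs of quantum states $\rho,\sigma$ on a common, arbitrary finite-dimensional Hilbert space, which (i) satisfies the data-processing inequality $\mathbb D(\mathcal E(\rho)\|\mathcal E(\sigma))\le\mathbb D(\rho\|\sigma)$ for every quantum channel $\mathcal E$, (ii) is additive, $\mathbb D(\rho_1\otimes\rho_2\|\sigma_1\otimes\sigma_2)=\mathbb D(\rho_1\|\sigma_1)+\mathbb D(\rho_2\|\sigma_2)$, and (iii) is normalized, $\mathbb D(|0\rangle\langle0|\,\|\,\tfrac12\mathbb 1)=1$ for a qubit. For a system of $n$ qutrits, let $\mathcal F_n$ be the set of stabilizer states, i.e. the convex hull of the states $U|0^n\rangle\langle0^n|U^\dagger$, where $U$ ranges over the Clifford group (the normalizer of the Heisenberg-Weyl group in the unitary group), and define the monotone $\mathfrak R(\rho)=\inf_{\sigma\in\mathcal F_n}\mathbb D(\rho\|\sigma)$ (a minimum whenever it is attained). A qutrit strange state is a pure state $|S\rangle\langle S|$ with $|S\rangle=(|1\rangle-|2\rangle)/\sqrt2$, up to single-qutrit Clifford unitaries.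 **Proposition.** For every quantum relative entropy $\mathbb D$ and any two qutrit strange states $\rho_1,\rho_2$ (in particular for two copies of $|S\rangle\langle S|$), the monotone $\mathfrak R$ is not additive on $\rho_1\otimes\rho_2$: $$\mathfrak R(\rho_1\otimes\rho_2)\neq\mathfrak R(\rho_1)+\mathfrak R(\rho_2).$$ -/

import Mathlib

open scoped Matrix Kronecker ComplexOrder

namespace Magic

/-! ### Quantum states, channels and relative entropies -/

/-- Quantum states on the finite-dimensional Hilbert space `ℂ^A`: positive semidefinite matrices
of unit trace. -/
def IsState {A : Type} [Fintype A] (ρ : Matrix A A ℂ) : Prop :=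
  ρ.PosSemidef ∧ ρ.trace = 1

/-- Quantum channels (completely positive trace-preserving maps), in operator-sum form. -/
def IsChannel {A B : Type} [Fintype A] [DecidableEq A] [Fintype B]
    (Φ : Matrix A A ℂ → Matrix B B ℂ) : Prop :=
  ∃ (r : ℕ) (K : Fin r → Matrix B A ℂ),
    ∑ i, (K i)ᴴ * K i = 1 ∧ ∀ X, Φ X = ∑ i, K i * X * (K i)ᴴ

/-- A quantum relative entropy: a function with values in `ℝ ∪ {+∞}` of pairs of states on the
same, arbitrary finite-dimensional system that satisfies the data-processing inequality, is
additive under tensor products, and is normalized by `𝔻(|0⟩⟨0| ‖ 𝟙/2) = 1` for a qubit.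
Values of `𝔻` on matrices that are not states are never used. -/
structure IsQuantumRelativeEntropy
    (𝔻 : ∀ (A : Type) [Fintype A], Matrix A A ℂ → Matrix A A ℂ → EReal) : Prop where
  ne_bot : ∀ (A : Type) [Fintype A] (ρ σ : Matrix A A ℂ),
    IsState ρ → IsState σ → 𝔻 A ρ σ ≠ ⊥
  data_processing : ∀ (A B : Type) [Fintype A] [DecidableEq A] [Fintype B]
    (Φ : Matrix A A ℂ → Matrix B B ℂ), IsChannel Φ → ∀ ρ σ : Matrix A A ℂ,
    IsState ρ → IsState σ → 𝔻 B (Φ ρ) (Φ σ) ≤ 𝔻 A ρ σ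
  additive : ∀ (A B : Type) [Fintype A] [Fintype B]
    (ρ₁ σ₁ : Matrix A A ℂ) (ρ₂ σ₂ : Matrix B B ℂ),
    IsState ρ₁ → IsState σ₁ → IsState ρ₂ → IsState σ₂ →
    𝔻 (A × B) (ρ₁ ⊗ₖ ρ₂) (σ₁ ⊗ₖ σ₂) = 𝔻 A ρ₁ σ₁ + 𝔻 B ρ₂ σ₂
  normalized : 𝔻 (Fin 2) (Matrix.single 0 0 1) ((1 / 2 : ℂ) • 1) = 1

/-! ### Stabilizer states

The computational basis is labelled by a finite abelian group `V`; for `n` qudits of dimension `d`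
this is `V = (ℤ/d)ⁿ`, so `V = ZMod 3` is a qutrit and `V = ZMod 3 × ZMod 3` is a pair of qutrits. -/

/-- The Heisenberg-Weyl operator `|j⟩ ↦ χ(j) |j + a⟩`. For `V = (ℤ/d)ⁿ` the characters are
`χ(j) = exp(2πi b·j/d)`, so that this is `X^a Z^b`, a tensor product of powers of the shift and
clock matrices. -/
def weyl {V : Type} [DecidableEq V] [AddCommGroup V] (a : V) (χ : AddChar V ℂ) :
    Matrix V V ℂ :=
  Matrix.of fun i j => if i = j + a then χ j else 0

theorem weyl_zero {V : Type} [DecidableEq V] [AddCommGroup V] :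
    weyl (0 : V) (1 : AddChar V ℂ) = 1 := by
  ext i j
  simp [weyl, Matrix.one_apply]

theorem weyl_mul {V : Type} [Fintype V] [DecidableEq V] [AddCommGroup V] (a b : V)
    (χ ψ : AddChar V ℂ) : weyl a χ * weyl b ψ = χ b • weyl (a + b) (χ * ψ) := by
  ext i j
  simp only [weyl, Matrix.mul_apply, Matrix.of_apply, Matrix.smul_apply, smul_eq_mul,
    mul_ite, mul_zero, Finset.sum_ite_eq', Finset.mem_univ, if_true, ite_mul,
    zero_mul, AddChar.mul_apply, AddChar.map_add_eq_mul]
  by_cases h : i = j + b + a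
  · rw [if_pos h, if_pos (by rw [h]; abel)]
    ring
  · rw [if_neg h, if_neg (fun h' => h (by rw [h']; abel))]

/-- The Heisenberg-Weyl (generalized Pauli) group: all Heisenberg-Weyl operators times phases. -/
def weylGroup (V : Type) [Fintype V] [DecidableEq V] [AddCommGroup V] :
    Subgroup (Matrix.unitaryGroup V ℂ) where
  carrier := {U | ∃ (c : ℂ) (a : V) (χ : AddChar V ℂ), (U : Matrix V V ℂ) = c • weyl a χ}
  mul_mem' := by
    rintro U W ⟨c, a, χ, hU⟩ ⟨c', b, ψ, hW⟩
    refine ⟨c * c' * χ b, a + b, χ * ψ, ?_⟩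
    rw [Matrix.UnitaryGroup.mul_val, hU, hW, Matrix.smul_mul, Matrix.mul_smul, weyl_mul,
      smul_smul, smul_smul]
  one_mem' := ⟨1, 0, 1, by rw [weyl_zero, one_smul]; rfl⟩
  inv_mem' := by
    rintro U ⟨c, a, χ, hU⟩
    refine ⟨c⁻¹ * χ a, -a, χ⁻¹, ?_⟩
    have hχ : χ a * χ (-a) = 1 := by
      rw [← AddChar.map_add_eq_mul, add_neg_cancel, AddChar.map_zero_eq_one]
    have h1 : weyl a χ * weyl (-a) χ⁻¹ = χ (-a) • (1 : Matrix V V ℂ) := by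
      rw [weyl_mul, add_neg_cancel, mul_inv_cancel, weyl_zero]
    have hc : c ≠ 0 := by
      rintro rfl
      have h := Matrix.mem_unitaryGroup_iff.mp U.2
      rw [hU, zero_smul, zero_mul] at h
      have h00 := congrFun (congrFun h 0) 0
      simp at h00
    have h2 : (U : Matrix V V ℂ) * ((c⁻¹ * χ a) • weyl (-a) χ⁻¹) = 1 := by
      rw [hU, Matrix.smul_mul, Matrix.mul_smul, h1, smul_smul, smul_smul]
      rw [show c * (c⁻¹ * χ a) * χ (-a) = (c * c⁻¹) * (χ a * χ (-a)) by ring, hχ,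
        mul_inv_cancel₀ hc, mul_one, one_smul]
    have h3 : ((U⁻¹ : Matrix.unitaryGroup V ℂ) : Matrix V V ℂ) * (U : Matrix V V ℂ) = 1 := by
      rw [← Matrix.UnitaryGroup.mul_val, inv_mul_cancel]
      rfl
    calc ((U⁻¹ : Matrix.unitaryGroup V ℂ) : Matrix V V ℂ)
        = (U⁻¹ : Matrix.unitaryGroup V ℂ).1 * ((U : Matrix V V ℂ) *
            ((c⁻¹ * χ a) • weyl (-a) χ⁻¹)) := by rw [h2, mul_one]
      _ = (c⁻¹ * χ a) • weyl (-a) χ⁻¹ := by rw [← mul_assoc, h3, one_mul]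

/-- The Clifford group: the unitaries that map the Heisenberg-Weyl group to itself under
conjugation. -/
def cliffordGroup (V : Type) [Fintype V] [DecidableEq V] [AddCommGroup V] :
    Subgroup (Matrix.unitaryGroup V ℂ) :=
  Subgroup.normalizer (weylGroup V : Set (Matrix.unitaryGroup V ℂ))

/-- The set of (mixed) stabilizer states: the convex hull of the pure stabilizer states
`U |0⟩⟨0| U†` with `U` in the Clifford group. -/
def stabilizerStates (V : Type) [Fintype V] [DecidableEq V] [AddCommGroup V] :
    Set (Matrix V V ℂ) :=
  convexHull ℝ {ρ | ∃ U ∈ cliffordGroup V,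
    ρ = (U : Matrix V V ℂ) * Matrix.single 0 0 1 * (U : Matrix V V ℂ)ᴴ}

/-- The magic monotone `ρ ↦ min_σ 𝔻(ρ ‖ σ)` based on `𝔻`, with `σ` ranging over the stabilizer
states. It is written as an infimum, which is the minimum whenever that is attained. -/
noncomputable def magicMonotone
    (𝔻 : ∀ (A : Type) [Fintype A], Matrix A A ℂ → Matrix A A ℂ → EReal)
    (V : Type) [Fintype V] [DecidableEq V] [AddCommGroup V] (ρ : Matrix V V ℂ) : EReal :=
  ⨅ σ ∈ stabilizerStates V, 𝔻 V ρ σ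

/-! ### Strange states -/

/-- The qutrit vector `|S⟩ = (|1⟩ - |2⟩) / √2`. -/
noncomputable def strangeKet : ZMod 3 → ℂ := fun j =>
  if j = 1 then 1 / (Real.sqrt 2 : ℂ) else if j = 2 then -1 / (Real.sqrt 2 : ℂ) else 0

/-- A pure qutrit strange state: `|S⟩⟨S|`, up to a single-qutrit Clifford unitary. -/
def IsStrangeState (ρ : Matrix (ZMod 3) (ZMod 3) ℂ) : Prop :=
  ∃ U ∈ cliffordGroup (ZMod 3), ρ = (U : Matrix (ZMod 3) (ZMod 3) ℂ) *
    Matrix.vecMulVec strangeKet (star strangeKet) * (U : Matrix (ZMod 3) (ZMod 3) ℂ)ᴴ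

end Magic

/-! Every quantum relative entropy is controlled by two operational quantities: an overlap bound
gives a lower bound, an operator inequality an upper one. Both come from data processing under a
measure-and-prepare channel, calibrated by the normalization. A stabilizer state has overlap at most
`1 / 2` with a strange state, so `one_le` gives the monotone value at least `1` on each factor, and
additivity would force at least `2` on the pair. However, `|S⟩ ⊗ |S⟩` is half the difference of the
indicators of the lines `y = x` and `y = -x`. Both indicators are stabilizer vectors up to
normalization, so the parallelogram identity shows that three times their even mixture `σ` dominates
the pair. Domination by a factor `3` suggests the bound `log₂ 3`; comparing three copies with five
normalizing qubits (`3 ^ 3 ≤ 2 ^ 5`) already gives `5 / 3 < 2` in `add_add_le_five`. -/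

namespace Magic

/-! ### Bounds on relative entropies from measure-and-prepare channels. -/

section Entropy

variable {A B : Type} [Fintype A] [Fintype B]

theorem IsState.kronecker {ρ : Matrix A A ℂ} {σ : Matrix B B ℂ} (hρ : IsState ρ)
    (hσ : IsState σ) : IsState (ρ ⊗ₖ σ) := by
  classical
  exact ⟨hρ.1.kronecker hσ.1, by rw [Matrix.trace_kronecker, hρ.2, hσ.2, mul_one]⟩

theorem isState_single [DecidableEq A] (a : A) : IsState (Matrix.single a a (1 : ℂ)) := by
  refine ⟨?_, Matrix.trace_single_eq_same _ _⟩
  rw [Matrix.single_eq_single_vecMulVec_single]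
  have h := Matrix.posSemidef_vecMulVec_self_star (Pi.single a (1 : ℂ))
  rwa [Pi.star_single, star_one] at h

theorem isState_half_one : IsState ((1 / 2 : ℂ) • (1 : Matrix (Fin 2) (Fin 2) ℂ)) := by
  refine ⟨Matrix.PosSemidef.one.smul (by positivity), ?_⟩
  rw [Matrix.trace_smul, Matrix.trace_one]
  simp

/-- Operator-sum forms may be indexed by an arbitrary finite type. -/
theorem isChannel_of_kraus [DecidableEq A] {ι : Type*} [Fintype ι]
    {Φ : Matrix A A ℂ → Matrix B B ℂ} (K : ι → Matrix B A ℂ) (hK : ∑ i, (K i)ᴴ * K i = 1)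
    (hΦ : ∀ X, Φ X = ∑ i, K i * X * (K i)ᴴ) : IsChannel Φ := by
  let e := Fintype.equivFin ι
  refine ⟨Fintype.card ι, fun i => K (e.symm i), ?_, fun X => ?_⟩
  · rw [← hK]
    exact e.symm.sum_comp fun i => (K i)ᴴ * K i
  · rw [hΦ]
    exact (e.symm.sum_comp fun i => K i * X * (K i)ᴴ).symm

open scoped MatrixOrder Matrix.Norms.L2Operator in
theorem exists_eq_conjTranspose_mul_self_of_posSemidef {M : Matrix B B ℂ}
    (hM : M.PosSemidef) : ∃ L : Matrix B B ℂ, M = Lᴴ * L := by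
  classical
  exact CStarAlgebra.nonneg_iff_eq_star_mul_self.mp hM.nonneg

/-- Measuring with the projections `P m` and preparing the state `ω m` on outcome `m` is a
channel. -/
theorem isChannel_measure_prepare [DecidableEq A] {μ : Type*} [Fintype μ]
    (P : μ → Matrix A A ℂ) (ω : μ → Matrix B B ℂ) (hP : ∀ m, (P m)ᴴ = P m)
    (hPP : ∀ m, P m * P m = P m) (hsum : ∑ m, P m = 1) (hω : ∀ m, IsState (ω m)) :
    IsChannel fun X => ∑ m, (P m * X).trace • ω m := by
  classical
  have hL : ∀ m, ∃ L : Matrix B B ℂ, ω m = Lᴴ * L := fun m =>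
    exists_eq_conjTranspose_mul_self_of_posSemidef (hω m).1
  choose L hL using hL
  have htr : ∀ m, ((L m) * (L m)ᴴ).trace = 1 := fun m => by
    rw [Matrix.trace_mul_comm, ← hL, (hω m).2]
  have hsingle : ∀ {C : Type} [Fintype C] {D : Type} [DecidableEq D] (a : D) (f : C → ℂ),
      ∑ c, Matrix.single a a (f c) = Matrix.single a a (∑ c, f c) := fun a f =>
    (map_sum (Matrix.singleAddMonoidHom a a) f Finset.univ).symm
  let E : B → A → Matrix B A ℂ := fun b a => Matrix.single b a 1
  have hE : ∀ b a, (E b a)ᴴ = Matrix.single a b 1 := fun b a => by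
    simp only [E, Matrix.conjTranspose_single, star_one]
  -- With `ω m = (L m)ᴴ * L m`, the Kraus operators are `(L m)ᴴ |b⟩⟨a| P m`: summing over `a`
  -- produces the trace, summing over `b` an identity between `(L m)ᴴ` and `L m`.
  refine isChannel_of_kraus
    (fun i : μ × B × A => (L i.1)ᴴ * E i.2.1 i.2.2 * P i.1) ?_ fun X => ?_
  · have key : ∀ m b a, ((L m)ᴴ * E b a * P m)ᴴ * ((L m)ᴴ * E b a * P m) =
        P m * Matrix.single a a ((L m * (L m)ᴴ) b b) * P m := by
      intro m b a
      have := Matrix.single_mul_mul_single a b b a (1 : ℂ) (L m * (L m)ᴴ) 1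
      rw [one_mul, mul_one] at this
      rw [← this, Matrix.conjTranspose_mul, Matrix.conjTranspose_mul, hE, hP,
        Matrix.conjTranspose_conjTranspose]
      simp only [E, Matrix.mul_assoc]
    simp only [Fintype.sum_prod_type, key]
    rw [← hsum]
    refine Finset.sum_congr rfl fun m _ => ?_
    rw [Finset.sum_comm]
    simp only [← Matrix.sum_mul, ← Matrix.mul_sum, hsingle]
    have h1 : ∑ b, (L m * (L m)ᴴ) b b = 1 := htr m
    rw [h1, Matrix.sum_single_one, mul_one, hPP]
  · have key : ∀ m b a, (L m)ᴴ * E b a * P m * X * ((L m)ᴴ * E b a * P m)ᴴ =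
        (L m)ᴴ * Matrix.single b b ((P m * X * P m) a a) * L m := by
      intro m b a
      have := Matrix.single_mul_mul_single b a a b (1 : ℂ) (P m * X * P m) 1
      rw [one_mul, mul_one] at this
      rw [← this, Matrix.conjTranspose_mul, Matrix.conjTranspose_mul, hE, hP,
        Matrix.conjTranspose_conjTranspose]
      simp only [E, Matrix.mul_assoc]
    simp only [Fintype.sum_prod_type, key]
    refine Finset.sum_congr rfl fun m _ => ?_
    simp only [← Matrix.sum_mul, ← Matrix.mul_sum, hsingle]
    have h1 : ∑ a, (P m * X * P m) a a = (P m * X).trace := by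
      exact (Matrix.trace_mul_comm (P m * X) (P m)).trans (by rw [← Matrix.mul_assoc, hPP])
    have h2 : ∑ b : B, Matrix.single b b ((P m * X).trace) =
        (P m * X).trace • (1 : Matrix B B ℂ) := by
      rw [← Matrix.sum_single_one, Finset.smul_sum]
      simp only [Matrix.smul_single, smul_eq_mul, mul_one]
    rw [h1, h2, Matrix.mul_smul, Matrix.smul_mul, mul_one, ← hL]

theorem isChannel_binary_measure_prepare [DecidableEq A] {P : Matrix A A ℂ}
    {ω₀ ω₁ : Matrix B B ℂ} (hP : Pᴴ = P) (hPP : P * P = P) (h₀ : IsState ω₀) (h₁ : IsState ω₁) :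
    IsChannel fun X => (P * X).trace • ω₀ + ((1 - P) * X).trace • ω₁ := by
  have h := isChannel_measure_prepare (μ := Fin 2) ![P, 1 - P] ![ω₀, ω₁]
    (by
      intro m
      fin_cases m
      · exact hP
      · simp [hP])
    (by
      intro m
      fin_cases m
      · exact hPP
      · simp [sub_mul, mul_sub, hPP])
    (by simp [Fin.sum_univ_two])
    (by
      intro m
      fin_cases m
      · exact h₀
      · exact h₁)
  simpa [Fin.sum_univ_two] using h

variable {𝔻 : ∀ (A : Type) [Fintype A], Matrix A A ℂ → Matrix A A ℂ → EReal}

/-- A projective state has relative entropy at least one bit to every state that has overlap at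
most one half with it. -/
theorem IsQuantumRelativeEntropy.one_le [DecidableEq A] (h : IsQuantumRelativeEntropy 𝔻)
    {ρ σ : Matrix A A ℂ} (hρ : IsState ρ) (hρρ : ρ * ρ = ρ) (hσ : IsState σ)
    (hle : (ρ * σ).trace ≤ 1 / 2) : 1 ≤ 𝔻 A ρ σ := by
  set p := (ρ * σ).trace with hp
  have h1p : 0 < 1 - p := by
    refine sub_pos.mpr (hle.trans_lt ?_)
    rw [div_lt_one (by norm_num)]
    norm_num
  -- `τ` solves `p |0⟩⟨0| + (1 - p) τ = 𝟙/2`, so that the channel below sends `ρ` to `|0⟩⟨0|` and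
  -- `σ` to `𝟙/2`. It is positive because `p ≤ 1 / 2`.
  set τ : Matrix (Fin 2) (Fin 2) ℂ :=
    (1 - p)⁻¹ • ((1 / 2 : ℂ) • (1 : Matrix (Fin 2) (Fin 2) ℂ) - p • Matrix.single 0 0 1) with hτ
  have hτs : IsState τ := by
    constructor
    · refine Matrix.PosSemidef.smul ?_ (inv_nonneg.mpr h1p.le)
      have : (1 / 2 : ℂ) • (1 : Matrix (Fin 2) (Fin 2) ℂ) - p • Matrix.single 0 0 1 =
          Matrix.diagonal ![1 / 2 - p, 1 / 2] := by
        ext i j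
        fin_cases i <;> fin_cases j <;> simp
      rw [this]
      refine Matrix.PosSemidef.diagonal fun i => ?_
      fin_cases i
      · exact sub_nonneg.mpr hle
      · simp
    · rw [hτ, Matrix.trace_smul, Matrix.trace_sub, Matrix.trace_smul, Matrix.trace_smul,
        Matrix.trace_one, Matrix.trace_single_eq_same]
      simp only [Fintype.card_fin, smul_eq_mul]
      have := h1p.ne'
      field_simp
      push_cast
      ring
  have hΦ := isChannel_binary_measure_prepare hρ.1.isHermitian hρρ
    (isState_single (0 : Fin 2)) hτs
  have hd := h.data_processing _ _ _ hΦ ρ σ hρ hσ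
  simp only [sub_mul, one_mul, hρρ, sub_self, Matrix.trace_sub, hρ.2, hσ.2, Matrix.trace_zero,
    one_smul, zero_smul, add_zero, ← hp] at hd
  rw [hτ, smul_smul, mul_inv_cancel₀ h1p.ne', one_smul, add_sub_cancel, h.normalized] at hd
  exact hd

/-- The relative entropy of a state to any state dominating a third of it is at most `5 / 3`:
indeed `3 ^ 3 ≤ 2 ^ 5`. -/
theorem IsQuantumRelativeEntropy.add_add_le_five (h : IsQuantumRelativeEntropy 𝔻)
    {ρ σ : Matrix A A ℂ} (hρ : IsState ρ) (hσ : IsState σ)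
    (hle : ((3 : ℂ) • σ - ρ).PosSemidef) : 𝔻 A ρ σ + 𝔻 A ρ σ + 𝔻 A ρ σ ≤ 5 := by
  classical
  -- Telescoping: `P ⊗ R - Q ⊗ S = (P - Q) ⊗ R + Q ⊗ (R - S)`.
  have hkron : ∀ {B C : Type} [Fintype B] [Fintype C] {P Q : Matrix B B ℂ} {R S : Matrix C C ℂ},
      (P - Q).PosSemidef → R.PosSemidef → Q.PosSemidef → (R - S).PosSemidef →
      (P ⊗ₖ R - Q ⊗ₖ S).PosSemidef := by
    intro B C _ _ P Q R S hPQ hR hQ hRS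
    have := (hPQ.kronecker hR).add (hQ.kronecker hRS)
    have e : P ⊗ₖ R - Q ⊗ₖ S = (P - Q) ⊗ₖ R + Q ⊗ₖ (R - S) := by
      ext ⟨i, k⟩ ⟨j, l⟩
      simp only [Matrix.sub_apply, Matrix.add_apply, Matrix.kronecker_apply]
      ring
    rwa [e]
  have h3 : ((3 : ℂ) • σ).PosSemidef := hσ.1.smul (by norm_num)
  have hρ2 := hρ.kronecker hρ
  have hσ2 := hσ.kronecker hσ
  have hρ3 := hρ2.kronecker hρ
  have hσ3 := hσ2.kronecker hσ
  set ρ3 := (ρ ⊗ₖ ρ) ⊗ₖ ρ with hρ3d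
  set σ3 := (σ ⊗ₖ σ) ⊗ₖ σ with hσ3d
  have h27 : ((27 : ℂ) • σ3 - ρ3).PosSemidef := by
    have := hkron (hkron hle h3 hρ.1 hle) h3 hρ2.1 hle
    convert this using 2
    simp only [Matrix.smul_kronecker, Matrix.kronecker_smul, smul_smul, hσ3d]
    norm_num
  -- This state solves `ρ3 / 32 + (31 / 32) τ = σ3`. Detecting `|0⟩⟨0|` on five qubits has
  -- probability `1 / 32` in the maximally mixed state, so the channel maps the five-qubit pair, of
  -- relative entropy `5`, to `(ρ3, σ3)`. Positivity has room to spare, as `27 ≤ 32`.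
  have hτs : IsState ((31 : ℂ)⁻¹ • ((32 : ℂ) • σ3 - ρ3)) := by
    constructor
    · refine Matrix.PosSemidef.smul ?_ (by positivity)
      have := h27.add (hσ3.1.smul (show (0 : ℂ) ≤ 5 by norm_num))
      convert this using 1
      module
    · rw [Matrix.trace_smul, Matrix.trace_sub, Matrix.trace_smul, hσ3.2, hρ3.2]
      norm_num
  have hz := isState_single (0 : Fin 2)
  have hi := isState_half_one
  have hz2 := hz.kronecker hz
  have hi2 := hi.kronecker hi
  have hz4 := hz2.kronecker hz2
  have hi4 := hi2.kronecker hi2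
  have hz5 := hz4.kronecker hz
  have hi5 := hi4.kronecker hi
  have e5 := h.additive _ _ _ _ _ _ hz4 hi4 hz hi
  rw [h.additive _ _ _ _ _ _ hz2 hi2 hz2 hi2, h.additive _ _ _ _ _ _ hz hi hz hi,
    h.normalized] at e5
  have e3 := h.additive _ _ _ _ _ _ hρ2 hσ2 hρ hσ
  rw [h.additive _ _ _ _ _ _ hρ hσ hρ hσ] at e3
  rw [← e3]
  simp only [Matrix.single_kronecker_single, Matrix.smul_kronecker, Matrix.kronecker_smul,
    Matrix.one_kronecker_one, smul_smul, mul_one] at hz5 hi5 e5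
  have hΦ := isChannel_binary_measure_prepare hz5.1.isHermitian
    (by rw [Matrix.single_mul_single_same, mul_one]) hρ3 hτs
  have hd := h.data_processing _ _ _ hΦ _ _ hz5 hi5
  rw [e5] at hd
  simp only [sub_mul, one_mul, Matrix.single_mul_single_same, mul_one, sub_self,
    Matrix.trace_zero, Matrix.trace_sub, Matrix.trace_smul, Matrix.mul_smul, zero_smul, one_smul,
    add_zero, Matrix.trace_single_eq_same, Matrix.trace_one] at hd
  refine le_trans (le_of_eq ?_) (hd.trans (le_of_eq ?_))
  · congr 1
    simp only [Fintype.card_prod, Fintype.card_fin, smul_smul]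
    push_cast
    norm_num
    module
  · norm_num

end Entropy

/-! ### Clifford unitaries: tensor products, label automorphisms, Fourier transform. -/

section Clifford

variable {V W : Type} [DecidableEq V] [AddCommGroup V] [DecidableEq W] [AddCommGroup W]

theorem weyl_prod (a : V × W) (χ : AddChar (V × W) ℂ) :
    weyl a χ = weyl a.1 (χ.compAddMonoidHom (AddMonoidHom.inl V W)) ⊗ₖ
      weyl a.2 (χ.compAddMonoidHom (AddMonoidHom.inr V W)) := by
  ext ⟨i, k⟩ ⟨j, l⟩
  have h : χ (j, l) = χ (j, 0) * χ (0, l) := by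
    rw [← AddChar.map_add_eq_mul, Prod.mk_add_mk, add_zero, zero_add]
  simp only [weyl, Matrix.of_apply, Matrix.kronecker_apply, Prod.ext_iff, Prod.fst_add,
    Prod.snd_add, AddChar.compAddMonoidHom_apply, AddMonoidHom.inl_apply,
    AddMonoidHom.inr_apply, h]
  by_cases h1 : i = j + a.1 <;> by_cases h2 : k = l + a.2 <;> simp [h1, h2]

theorem weyl_kronecker (a : V) (χ : AddChar V ℂ) (b : W) (ψ : AddChar W ℂ) :
    weyl a χ ⊗ₖ weyl b ψ = weyl (a, b) (χ.compAddMonoidHom (AddMonoidHom.fst V W) *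
      ψ.compAddMonoidHom (AddMonoidHom.snd V W)) := by
  rw [weyl_prod]
  congr 2 <;> ext x <;> simp

/-- The permutation matrix of an automorphism of the label group. -/
def automorphismMatrix (f : V ≃+ V) : Matrix V V ℂ :=
  Matrix.of fun i j => if i = f j then 1 else 0

theorem automorphismMatrix_conjTranspose (f : V ≃+ V) :
    (automorphismMatrix f)ᴴ = automorphismMatrix f.symm := by
  ext i j
  simp only [automorphismMatrix, Matrix.conjTranspose_apply, Matrix.of_apply]
  by_cases h : j = f i
  · simp [h]
  · have : ¬ i = f.symm j := by
      rintro rfl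
      simp at h
    simp [h, this]

variable [Fintype V] [Fintype W]

theorem weyl_mem_unitaryGroup (a : V) (χ : AddChar V ℂ) :
    weyl a χ ∈ Matrix.unitaryGroup V ℂ := by
  rw [Matrix.mem_unitaryGroup_iff']
  ext i k
  simp only [weyl, Matrix.star_eq_conjTranspose, Matrix.mul_apply, Matrix.conjTranspose_apply,
    Matrix.of_apply, mul_ite, mul_zero, Finset.sum_ite_eq', Finset.mem_univ, if_true,
    add_left_inj, Matrix.one_apply]
  by_cases h : i = k
  · subst h
    simp [← starRingEnd_apply, ← Complex.normSq_eq_conj_mul_self, Complex.normSq_eq_norm_sq]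
  · simp [h, Ne.symm h]

/-- The matrix `U` conjugates Heisenberg-Weyl operators to multiples of such. -/
def MapsWeyl (U : Matrix V V ℂ) : Prop :=
  ∀ (a : V) (χ : AddChar V ℂ), ∃ (c : ℂ) (b : V) (ψ : AddChar V ℂ),
    U * weyl a χ = c • (weyl b ψ * U)

theorem MapsWeyl.conj_mem {U : Matrix.unitaryGroup V ℂ} (hU : MapsWeyl (U : Matrix V V ℂ))
    {w : Matrix.unitaryGroup V ℂ} (hw : w ∈ weylGroup V) : U * w * U⁻¹ ∈ weylGroup V := by
  obtain ⟨c, a, χ, h⟩ := hw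
  obtain ⟨c', b, ψ, h'⟩ := hU a χ
  refine ⟨c * c', b, ψ, ?_⟩
  have hU1 : (U : Matrix V V ℂ) * (U⁻¹ : Matrix.unitaryGroup V ℂ) = 1 := by
    rw [← Matrix.UnitaryGroup.mul_val, mul_inv_cancel]
    rfl
  rw [Matrix.UnitaryGroup.mul_val, Matrix.UnitaryGroup.mul_val, h, Matrix.mul_smul, h',
    smul_smul, Matrix.smul_mul, Matrix.mul_assoc, hU1, mul_one]

theorem mapsWeyl_of_mem_cliffordGroup {U : Matrix.unitaryGroup V ℂ}
    (hU : U ∈ cliffordGroup V) : MapsWeyl (U : Matrix V V ℂ) := by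
  intro a χ
  have hw : (⟨weyl a χ, weyl_mem_unitaryGroup a χ⟩ : Matrix.unitaryGroup V ℂ) ∈ weylGroup V :=
    ⟨1, a, χ, (one_smul _ _).symm⟩
  obtain ⟨c, b, ψ, h⟩ := (Subgroup.mem_normalizer_iff.mp hU _).mp hw
  refine ⟨c, b, ψ, ?_⟩
  have h2 : ((U⁻¹ : Matrix.unitaryGroup V ℂ) : Matrix V V ℂ) * U = 1 := by
    rw [← Matrix.UnitaryGroup.mul_val, inv_mul_cancel]
    rfl
  rw [← Matrix.smul_mul, ← h, Matrix.UnitaryGroup.mul_val, Matrix.UnitaryGroup.mul_val,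
    Matrix.mul_assoc, h2, mul_one]

/-- Reduces Clifford membership to intertwining relations free of inverses. The normalizer condition
is an equivalence, so the adjoint, which is the inverse, must satisfy the relation too. -/
theorem mem_cliffordGroup_iff {U : Matrix.unitaryGroup V ℂ} :
    U ∈ cliffordGroup V ↔
      MapsWeyl (U : Matrix V V ℂ) ∧ MapsWeyl (U : Matrix V V ℂ)ᴴ := by
  constructor
  · intro hU
    exact ⟨mapsWeyl_of_mem_cliffordGroup hU, mapsWeyl_of_mem_cliffordGroup (inv_mem hU)⟩
  · rintro ⟨h, h'⟩
    refine Subgroup.mem_normalizer_iff.mpr fun w => ⟨h.conj_mem, fun hw => ?_⟩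
    have := MapsWeyl.conj_mem (U := U⁻¹) h' hw
    rwa [inv_inv, show U⁻¹ * (U * w * U⁻¹) * U = w by group] at this

theorem MapsWeyl.kronecker {U : Matrix V V ℂ} {U' : Matrix W W ℂ} (h : MapsWeyl U)
    (h' : MapsWeyl U') : MapsWeyl (U ⊗ₖ U') := by
  intro a χ
  obtain ⟨c, b, ψ, e⟩ := h a.1 (χ.compAddMonoidHom (AddMonoidHom.inl V W))
  obtain ⟨c', b', ψ', e'⟩ := h' a.2 (χ.compAddMonoidHom (AddMonoidHom.inr V W))
  refine ⟨c * c', (b, b'), ψ.compAddMonoidHom (AddMonoidHom.fst V W) *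
    ψ'.compAddMonoidHom (AddMonoidHom.snd V W), ?_⟩
  rw [← weyl_kronecker b ψ b' ψ', weyl_prod, ← Matrix.mul_kronecker_mul, e, e',
    Matrix.smul_kronecker, Matrix.kronecker_smul, smul_smul, Matrix.mul_kronecker_mul]

theorem exists_mem_cliffordGroup_kronecker {U : Matrix.unitaryGroup V ℂ}
    {U' : Matrix.unitaryGroup W ℂ} (h : U ∈ cliffordGroup V) (h' : U' ∈ cliffordGroup W) :
    ∃ T ∈ cliffordGroup (V × W),
      (T : Matrix (V × W) (V × W) ℂ) = (U : Matrix V V ℂ) ⊗ₖ (U' : Matrix W W ℂ) := by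
  rw [mem_cliffordGroup_iff] at h h'
  refine ⟨⟨_, Matrix.kronecker_mem_unitary U.2 U'.2⟩, mem_cliffordGroup_iff.mpr ⟨?_, ?_⟩, rfl⟩
  · exact h.1.kronecker h'.1
  · rw [Matrix.conjTranspose_kronecker]
    exact h.2.kronecker h'.2

theorem automorphismMatrix_mul_apply (f : V ≃+ V) (M : Matrix V V ℂ) (i j : V) :
    (automorphismMatrix f * M) i j = M (f.symm i) j := by
  simp only [automorphismMatrix, Matrix.mul_apply, Matrix.of_apply, ite_mul, one_mul, zero_mul]
  rw [Finset.sum_eq_single (f.symm i)]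
  · simp
  · intro b _ hb
    rw [if_neg]
    rintro rfl
    simp at hb
  · simp

theorem mapsWeyl_automorphismMatrix (f : V ≃+ V) : MapsWeyl (automorphismMatrix f) := by
  intro a χ
  refine ⟨1, f a, χ.compAddMonoidHom f.symm.toAddMonoidHom, ?_⟩
  ext i j
  rw [automorphismMatrix_mul_apply, one_smul]
  simp only [weyl, automorphismMatrix, Matrix.mul_apply, Matrix.of_apply, mul_ite, mul_one,
    mul_zero, Finset.sum_ite_eq', Finset.mem_univ, if_true]
  have : f.symm i = j + a ↔ i = f j + f a := by
    rw [← map_add, AddEquiv.symm_apply_eq]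
  simp [this]

theorem exists_mem_cliffordGroup_automorphismMatrix (f : V ≃+ V) :
    ∃ T ∈ cliffordGroup V, (T : Matrix V V ℂ) = automorphismMatrix f := by
  have hu : automorphismMatrix f ∈ Matrix.unitaryGroup V ℂ := by
    rw [Matrix.mem_unitaryGroup_iff, Matrix.star_eq_conjTranspose,
      automorphismMatrix_conjTranspose]
    ext i j
    rw [automorphismMatrix_mul_apply]
    simp [automorphismMatrix, Matrix.one_apply]
  refine ⟨⟨_, hu⟩, mem_cliffordGroup_iff.mpr ⟨mapsWeyl_automorphismMatrix f, ?_⟩, rfl⟩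
  rw [automorphismMatrix_conjTranspose]
  exact mapsWeyl_automorphismMatrix f.symm

/-- The Fourier matrix of the qutrit with respect to an additive character. -/
noncomputable def fourierMatrix (ψ : AddChar (ZMod 3) ℂ) : Matrix (ZMod 3) (ZMod 3) ℂ :=
  Matrix.of fun i j => (Real.sqrt 3 : ℂ)⁻¹ * ψ (i * j)

theorem fourierMatrix_conjTranspose (ψ : AddChar (ZMod 3) ℂ) :
    (fourierMatrix ψ)ᴴ = fourierMatrix ψ⁻¹ := by
  ext i j
  simp [fourierMatrix, Matrix.conjTranspose_apply, ← starRingEnd_apply,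
    ← AddChar.map_neg_eq_conj, mul_comm i j]

/-- Primitivity makes `b ↦ ψ.mulShift b` injective, and a finite abelian group has as many
characters as elements. -/
theorem exists_eq_mulShift {ψ : AddChar (ZMod 3) ℂ} (hψ : ψ.IsPrimitive)
    (χ : AddChar (ZMod 3) ℂ) : ∃ b, χ = ψ.mulShift b := by
  have hinj := AddChar.to_mulShift_inj_of_isPrimitive hψ
  have := ((Fintype.bijective_iff_injective_and_card _).mpr
    ⟨hinj, AddChar.card_eq.symm⟩).surjective χ
  obtain ⟨b, hb⟩ := this
  exact ⟨b, hb.symm⟩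

theorem mapsWeyl_fourierMatrix {ψ : AddChar (ZMod 3) ℂ} (hψ : ψ.IsPrimitive) :
    MapsWeyl (fourierMatrix ψ) := by
  intro a χ
  obtain ⟨b, rfl⟩ := exists_eq_mulShift hψ χ
  -- The Fourier transform exchanges shifts and characters; the phase comes from `a * (i + b) = a *
  -- i + a * b`.
  refine ⟨ψ (-b * a), -b, ψ.mulShift a, ?_⟩
  ext i j
  simp only [weyl, fourierMatrix, Matrix.mul_apply, Matrix.smul_apply, Matrix.of_apply, mul_ite,
    mul_zero, ite_mul, zero_mul, Finset.sum_ite_eq', Finset.mem_univ, if_true, smul_eq_mul,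
    AddChar.mulShift_apply]
  rw [Finset.sum_eq_single (i + b)]
  · rw [if_pos (by abel), mul_assoc, ← AddChar.map_add_eq_mul, mul_left_comm (ψ (a * (i + b))),
      mul_left_comm (ψ (-b * a)), ← AddChar.map_add_eq_mul, ← AddChar.map_add_eq_mul]
    congr 2
    ring
  · intro k _ hk
    rw [if_neg]
    rintro rfl
    simp at hk
  · simp

theorem exists_mem_cliffordGroup_fourierMatrix {ψ : AddChar (ZMod 3) ℂ} (hψ : ψ.IsPrimitive) :
    ∃ T ∈ cliffordGroup (ZMod 3), (T : Matrix (ZMod 3) (ZMod 3) ℂ) = fourierMatrix ψ := by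
  have hψ' : ψ⁻¹.IsPrimitive := by
    intro a ha h
    refine hψ ha ?_
    ext x
    have := DFunLike.congr_fun h (-x)
    simpa [AddChar.mulShift_apply] using this
  have h3 : (Real.sqrt 3 : ℂ)⁻¹ * (Real.sqrt 3 : ℂ)⁻¹ = 3⁻¹ := by
    rw [← mul_inv, ← Complex.ofReal_mul, Real.mul_self_sqrt (by norm_num)]
    norm_num
  have hu : fourierMatrix ψ ∈ Matrix.unitaryGroup (ZMod 3) ℂ := by
    rw [Matrix.mem_unitaryGroup_iff', Matrix.star_eq_conjTranspose, fourierMatrix_conjTranspose]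
    ext i k
    have h := AddChar.sum_mulShift (k - i) hψ
    have h' : (fourierMatrix ψ⁻¹ * fourierMatrix ψ) i k =
        3⁻¹ * ∑ x, ψ (x * (k - i)) := by
      rw [Matrix.mul_apply, Finset.mul_sum]
      refine Finset.sum_congr rfl fun j _ => ?_
      simp only [fourierMatrix, Matrix.of_apply, AddChar.inv_apply]
      rw [mul_mul_mul_comm, h3, ← AddChar.map_add_eq_mul]
      congr 2
      ring
    rw [h', h, Matrix.one_apply]
    by_cases hik : i = k
    · simp [hik, ZMod.card]
    · simp [hik, sub_eq_zero, Ne.symm hik]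
  refine ⟨⟨_, hu⟩, mem_cliffordGroup_iff.mpr ⟨mapsWeyl_fourierMatrix hψ, ?_⟩, rfl⟩
  rw [fourierMatrix_conjTranspose]
  exact mapsWeyl_fourierMatrix hψ'

end Clifford

/-! ### Convexity of the stabilizer states. -/

section Stabilizer

variable {V : Type} [Fintype V]

theorem convex_isState : Convex ℝ {ρ : Matrix V V ℂ | IsState ρ} := by
  intro ρ hρ σ hσ a b ha hb hab
  refine ⟨(hρ.1.smul ha).add (hσ.1.smul hb), ?_⟩
  rw [Matrix.trace_add, Matrix.trace_smul, Matrix.trace_smul, hρ.2, hσ.2, ← add_smul, hab,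
    one_smul]

variable [DecidableEq V]

theorem IsState.unitary_conj {ρ : Matrix V V ℂ} (hρ : IsState ρ) (U : Matrix.unitaryGroup V ℂ) :
    IsState ((U : Matrix V V ℂ) * ρ * (U : Matrix V V ℂ)ᴴ) := by
  refine ⟨hρ.1.mul_mul_conjTranspose_same _, ?_⟩
  have h := Matrix.mem_unitaryGroup_iff'.mp U.2
  rw [Matrix.star_eq_conjTranspose] at h
  rw [Matrix.trace_mul_cycle, h, one_mul, hρ.2]

variable [AddCommGroup V]

theorem isState_of_mem_stabilizerStates {σ : Matrix V V ℂ} (hσ : σ ∈ stabilizerStates V) :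
    IsState σ := by
  refine convexHull_min ?_ convex_isState hσ
  rintro _ ⟨U, -, rfl⟩
  exact (isState_single 0).unitary_conj U

theorem trace_mul_le_of_mem_stabilizerStates {ρ σ : Matrix V V ℂ} {c : ℂ}
    (h : ∀ U ∈ cliffordGroup V,
      (ρ * ((U : Matrix V V ℂ) * Matrix.single 0 0 1 * (U : Matrix V V ℂ)ᴴ)).trace ≤ c)
    (hσ : σ ∈ stabilizerStates V) : (ρ * σ).trace ≤ c := by
  have hconv : Convex ℝ {σ : Matrix V V ℂ | (ρ * σ).trace ≤ c} := by
    intro σ hσ τ hτ a b ha hb hab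
    simp only [Set.mem_ofPred_eq, Matrix.mul_add, Matrix.mul_smul, Matrix.trace_add,
      Matrix.trace_smul] at hσ hτ ⊢
    calc _ ≤ a • c + b • c :=
          add_le_add (smul_le_smul_of_nonneg_left hσ ha) (smul_le_smul_of_nonneg_left hτ hb)
      _ = c := by rw [← add_smul, hab, one_smul]
  refine convexHull_min ?_ hconv hσ
  rintro _ ⟨U, hU, rfl⟩
  exact h U hU

theorem mul_single_mul_conjTranspose (U : Matrix V V ℂ) :
    U * Matrix.single 0 0 1 * Uᴴ =
      Matrix.vecMulVec (fun i => U i 0) (star fun i => U i 0) := by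
  ext i j
  simp [Matrix.mul_apply, Matrix.single_apply, Matrix.vecMulVec_apply, ite_and]

end Stabilizer

/-! ### The first column of a qutrit Clifford unitary. -/

section Strange

/-- The first column of a qutrit Clifford unitary has entries of equal modulus whose ratios are
cube roots of unity, or else it is a multiple of a basis vector. -/
theorem normSq_sub_le_of_mem_cliffordGroup {U : Matrix.unitaryGroup (ZMod 3) ℂ}
    (hU : U ∈ cliffordGroup (ZMod 3)) :
    Complex.normSq ((U : Matrix (ZMod 3) (ZMod 3) ℂ) 1 0 -
      (U : Matrix (ZMod 3) (ZMod 3) ℂ) 2 0) ≤ 1 := by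
  set ψ : AddChar (ZMod 3) ℂ := ZMod.stdAddChar
  -- The clock operator fixes `|0⟩`, so column `0` of `U` is fixed by `c • weyl a χ`. The value of
  -- `a` decides the shape of the column.
  obtain ⟨c, a, χ, h⟩ := mapsWeyl_of_mem_cliffordGroup hU 0 ψ
  have hunit : star (U : Matrix (ZMod 3) (ZMod 3) ℂ) * (U : Matrix (ZMod 3) (ZMod 3) ℂ) = 1 :=
    Matrix.mem_unitaryGroup_iff'.mp U.2
  generalize (U : Matrix (ZMod 3) (ZMod 3) ℂ) = M at *
  have hent : ∀ i j, M (i + a) j * ψ j = c * (χ i * M i j) := by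
    intro i j
    have := congrFun (congrFun h (i + a)) j
    simpa [weyl, Matrix.mul_apply] using this
  have hv : ∀ i, M (i + a) 0 = c * (χ i * M i 0) := fun i => by simpa using hent i 0
  have hnorm : ∀ j, Complex.normSq (M 0 j) + Complex.normSq (M 1 j) +
      Complex.normSq (M 2 j) = 1 := by
    intro j
    have h0 := congrFun (congrFun hunit j) j
    have h1 : ∀ f : ZMod 3 → ℂ, ∑ x, f x = f 0 + f 1 + f 2 := fun f => Fin.sum_univ_three f
    rw [Matrix.mul_apply, h1] at h0
    simp only [Matrix.star_apply, ← starRingEnd_apply, ← Complex.normSq_eq_conj_mul_self,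
      Matrix.one_apply_eq] at h0
    exact_mod_cast h0
  have hχ0 : χ 0 = 1 := χ.map_zero_eq_one
  have hχ2 : χ 2 = χ 1 * χ 1 := by
    rw [← AddChar.map_add_eq_mul]
    rfl
  have hχ3 : χ 1 * χ 1 * χ 1 = 1 := by
    rw [← hχ2, ← AddChar.map_add_eq_mul, ← hχ0]
    rfl
  have hcube : ∀ {w : ℂ}, w ^ 3 = 1 → Complex.normSq w = 1 := by
    intro w hw
    rw [Complex.normSq_eq_norm_sq, Complex.norm_eq_one_of_pow_eq_one hw (by norm_num), one_pow]
  -- The three moduli agree, so `|x|² = 1 / 3`, while `|1 - w|² ≤ 3` for a cube root of unity.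
  have hroot : ∀ {w x y z : ℂ}, w ^ 3 = 1 → y = w * x → Complex.normSq z = Complex.normSq x →
      Complex.normSq z + Complex.normSq x + Complex.normSq y = 1 →
      Complex.normSq (x - y) ≤ 1 := by
    intro w x y z hw hy hz hs
    have hw1 := hcube hw
    have hwle : Complex.normSq (1 - w) ≤ 3 := by
      have hf : (w - 1) * (w ^ 2 + w + 1) = 0 := by linear_combination hw
      rcases mul_eq_zero.mp hf with h | h
      · rw [show 1 - w = -(w - 1) by ring, h]
        simp
      · have hc : (starRingEnd ℂ) w = w ^ 2 := by
          have := Complex.normSq_eq_conj_mul_self (z := w)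
          rw [hw1] at this
          push_cast at this
          calc (starRingEnd ℂ) w = (starRingEnd ℂ) w * w ^ 3 := by rw [hw, mul_one]
            _ = ((starRingEnd ℂ) w * w) * w ^ 2 := by ring
            _ = w ^ 2 := by rw [← this, one_mul]
        have := Complex.normSq_eq_conj_mul_self (z := 1 - w)
        rw [map_sub (starRingEnd ℂ), map_one (starRingEnd ℂ), hc] at this
        have h3 : ((Complex.normSq (1 - w) : ℝ) : ℂ) = ((3 : ℝ) : ℂ) := by
          rw [this]
          push_cast
          linear_combination hw - h
        exact (Complex.ofReal_injective h3).le
    have hyx : Complex.normSq y = Complex.normSq x := by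
      rw [hy, Complex.normSq_mul, hw1, one_mul]
    rw [show x - y = (1 - w) * x by rw [hy]; ring, Complex.normSq_mul]
    nlinarith [Complex.normSq_nonneg x]
  have hn := hnorm 0
  have hz3 : χ 1 ^ 3 = 1 := by linear_combination hχ3
  have hcases : ∀ a : ZMod 3, a = 0 ∨ a = 1 ∨ a = 2 := by decide
  rcases hcases a with rfl | rfl | rfl
  · have h1 : M 1 0 = c * (χ 1 * M 1 0) := hv 1
    have h2 : M 2 0 = c * (χ 2 * M 2 0) := hv 2
    -- If both entries were nonzero, then `c = 1` and `χ` would be trivial. The clock operator would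
    -- then act trivially, which would annihilate column `1`.
    have hzero : M 1 0 = 0 ∨ M 2 0 = 0 := by
      by_contra! hne
      have e1 : c * χ 1 = 1 := by
        have : (c * χ 1 - 1) * M 1 0 = 0 := by linear_combination -h1
        exact sub_eq_zero.mp ((mul_eq_zero.mp this).resolve_right hne.1)
      have e2 : c * χ 1 * χ 1 = 1 := by
        have : (c * χ 1 * χ 1 - 1) * M 2 0 = 0 := by
          rw [hχ2] at h2
          linear_combination -h2
        exact sub_eq_zero.mp ((mul_eq_zero.mp this).resolve_right hne.2)
      have hχ1 : χ 1 = 1 := by rw [← e2, e1, one_mul]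
      have hc : c = 1 := by rw [← e1, hχ1, mul_one]
      have hχ : ∀ i, χ i = 1 := by
        intro i
        rcases hcases i with rfl | rfl | rfl
        · exact hχ0
        · exact hχ1
        · rw [hχ2, hχ1, one_mul]
      have hψ1 : ψ 1 ≠ 1 := by
        intro h1
        have : (1 : ZMod 3) = 0 :=
          ZMod.injective_stdAddChar (h1.trans (AddChar.map_zero_eq_one _).symm)
        exact absurd this (by decide)
      have hM : ∀ i, M i 1 = 0 := by
        intro i
        have h3 := hent i 1
        rw [add_zero, hc, hχ, one_mul, one_mul] at h3
        have : M i 1 * (ψ 1 - 1) = 0 := by linear_combination h3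
        exact (mul_eq_zero.mp this).resolve_right (sub_ne_zero.mpr hψ1)
      have := hnorm 1
      simp [hM] at this
    rcases hzero with h0 | h0
    · rw [h0, zero_sub, Complex.normSq_neg]
      linarith [Complex.normSq_nonneg (M 0 0), Complex.normSq_nonneg (M 1 0)]
    · rw [h0, sub_zero]
      linarith [Complex.normSq_nonneg (M 0 0), Complex.normSq_nonneg (M 2 0)]
  · have h0 : M 1 0 = c * (χ 0 * M 0 0) := hv 0
    have h1 : M 2 0 = c * (χ 1 * M 1 0) := hv 1
    have h2 : M 0 0 = c * (χ 2 * M 2 0) := hv 2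
    rw [hχ0, one_mul] at h0
    rw [hχ2] at h2
    have hne : M 0 0 ≠ 0 := by
      intro h
      rw [h1, h0, h] at hn
      simp at hn
    -- Going once around the cycle of three labels multiplies the entry by `c ^ 3 * χ 1 ^ 3`.
    have hc : c ^ 3 = 1 := by
      have : (c ^ 3 - 1) * M 0 0 = 0 := by
        rw [h1, h0] at h2
        linear_combination -h2 - c ^ 3 * M 0 0 * hz3
      exact sub_eq_zero.mp ((mul_eq_zero.mp this).resolve_right hne)
    refine hroot (w := c * χ 1) (z := M 0 0) (by rw [mul_pow, hc, hz3, one_mul])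
      (by rw [h1, mul_assoc]) ?_ (by linarith)
    rw [h0, Complex.normSq_mul, hcube hc, one_mul]
  · have h0 : M 2 0 = c * (χ 0 * M 0 0) := hv 0
    have h1 : M 0 0 = c * (χ 1 * M 1 0) := hv 1
    have h2 : M 1 0 = c * (χ 2 * M 2 0) := hv 2
    rw [hχ0, one_mul] at h0
    rw [hχ2] at h2
    have hne : M 1 0 ≠ 0 := by
      intro h
      rw [h0, h1, h] at hn
      simp at hn
    have hc : c ^ 3 = 1 := by
      have : (c ^ 3 - 1) * M 1 0 = 0 := by
        rw [h0, h1] at h2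
        linear_combination -h2 - c ^ 3 * M 1 0 * hz3
      exact sub_eq_zero.mp ((mul_eq_zero.mp this).resolve_right hne)
    refine hroot (w := c ^ 2 * χ 1) (z := M 0 0) ?_ (by rw [h0, h1]; ring) ?_ (by linarith)
    · rw [mul_pow, hz3, ← pow_mul, mul_comm 2 3, pow_mul, hc, one_pow, one_mul]
    · rw [h1, Complex.normSq_mul, Complex.normSq_mul, hcube hc, hcube hz3, one_mul, one_mul]

end Strange

/-! ### Strange states: overlap bound and dominating stabilizer state. -/

section Strange

theorem inv_sqrt_two_mul_self : (Real.sqrt 2 : ℂ)⁻¹ * (Real.sqrt 2 : ℂ)⁻¹ = 2⁻¹ := by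
  rw [← mul_inv, ← Complex.ofReal_mul, Real.mul_self_sqrt (by norm_num)]
  norm_num

theorem strangeKet_zero : strangeKet 0 = 0 := by
  rw [strangeKet, if_neg (by decide), if_neg (by decide)]

theorem strangeKet_one : strangeKet 1 = (Real.sqrt 2 : ℂ)⁻¹ := by
  rw [strangeKet, if_pos rfl, one_div]

theorem strangeKet_two : strangeKet 2 = -(Real.sqrt 2 : ℂ)⁻¹ := by
  rw [strangeKet, if_neg (by decide), if_pos rfl, neg_div, one_div]

theorem zmod_three_cases (i : ZMod 3) : i = 0 ∨ i = 1 ∨ i = 2 := by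
  revert i
  decide

theorem star_strangeKet : star strangeKet = strangeKet := by
  ext i
  rw [Pi.star_apply]
  rcases zmod_three_cases i with rfl | rfl | rfl
  · rw [strangeKet_zero, star_zero]
  · rw [strangeKet_one, ← starRingEnd_apply, map_inv₀, Complex.conj_ofReal]
  · rw [strangeKet_two, ← starRingEnd_apply, map_neg, map_inv₀, Complex.conj_ofReal]

theorem strangeKet_dotProduct (v : ZMod 3 → ℂ) :
    strangeKet ⬝ᵥ v = (Real.sqrt 2 : ℂ)⁻¹ * (v 1 - v 2) := by
  have h1 : strangeKet ⬝ᵥ v = strangeKet 0 * v 0 + strangeKet 1 * v 1 + strangeKet 2 * v 2 :=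
    Fin.sum_univ_three fun i : ZMod 3 => strangeKet i * v i
  rw [h1, strangeKet_zero, strangeKet_one, strangeKet_two]
  ring

theorem strangeKet_dotProduct_self : strangeKet ⬝ᵥ strangeKet = 1 := by
  rw [strangeKet_dotProduct, strangeKet_one, strangeKet_two, sub_neg_eq_add, mul_add,
    inv_sqrt_two_mul_self]
  norm_num

/-- The strange state `|S⟩⟨S|`. -/
noncomputable def strangeProj : Matrix (ZMod 3) (ZMod 3) ℂ :=
  Matrix.vecMulVec strangeKet (star strangeKet)

theorem isState_strangeProj : IsState strangeProj :=
  ⟨Matrix.posSemidef_vecMulVec_self_star _, by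
    rw [strangeProj, Matrix.trace_vecMulVec, star_strangeKet, strangeKet_dotProduct_self]⟩

theorem strangeProj_mul_self : strangeProj * strangeProj = strangeProj := by
  rw [strangeProj, Matrix.vecMulVec_mul_vecMulVec, star_strangeKet, strangeKet_dotProduct_self,
    one_smul]

/-- With `u` the first column of `U`, the overlap equals `|u 1 - u 2|² / 2`. -/
theorem trace_strangeProj_mul_le {U : Matrix.unitaryGroup (ZMod 3) ℂ}
    (hU : U ∈ cliffordGroup (ZMod 3)) :
    (strangeProj * ((U : Matrix (ZMod 3) (ZMod 3) ℂ) * Matrix.single 0 0 1 *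
      (U : Matrix (ZMod 3) (ZMod 3) ℂ)ᴴ)).trace ≤ 1 / 2 := by
  have h := normSq_sub_le_of_mem_cliffordGroup hU
  rw [mul_single_mul_conjTranspose, strangeProj, Matrix.vecMulVec_mul_vecMulVec,
    Matrix.trace_vecMulVec, dotProduct_smul, star_strangeKet, strangeKet_dotProduct,
    strangeKet_dotProduct, smul_eq_mul, Pi.star_apply, Pi.star_apply, ← star_sub,
    mul_mul_mul_comm, inv_sqrt_two_mul_self, ← starRingEnd_apply, Complex.mul_conj]
  calc _ = (((2 : ℝ)⁻¹ * Complex.normSq ((U : Matrix (ZMod 3) (ZMod 3) ℂ) 1 0 -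
        (U : Matrix (ZMod 3) (ZMod 3) ℂ) 2 0) : ℝ) : ℂ) := by push_cast; rfl
    _ ≤ ((1 / 2 : ℝ) : ℂ) := Complex.real_le_real.mpr (by linarith)
    _ = 1 / 2 := by push_cast; rfl

theorem IsStrangeState.isState {ρ : Matrix (ZMod 3) (ZMod 3) ℂ} (h : IsStrangeState ρ) :
    IsState ρ := by
  obtain ⟨U, -, rfl⟩ := h
  exact isState_strangeProj.unitary_conj U

theorem IsStrangeState.mul_self {ρ : Matrix (ZMod 3) (ZMod 3) ℂ} (h : IsStrangeState ρ) :
    ρ * ρ = ρ := by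
  obtain ⟨U, -, rfl⟩ := h
  have hU := Matrix.mem_unitaryGroup_iff'.mp U.2
  rw [Matrix.star_eq_conjTranspose] at hU
  change (U : Matrix (ZMod 3) (ZMod 3) ℂ) * strangeProj * (U : Matrix (ZMod 3) (ZMod 3) ℂ)ᴴ *
    ((U : Matrix (ZMod 3) (ZMod 3) ℂ) * strangeProj * (U : Matrix (ZMod 3) (ZMod 3) ℂ)ᴴ) =
    (U : Matrix (ZMod 3) (ZMod 3) ℂ) * strangeProj * (U : Matrix (ZMod 3) (ZMod 3) ℂ)ᴴ
  generalize (U : Matrix (ZMod 3) (ZMod 3) ℂ) = M at *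
  calc _ = M * strangeProj * (Mᴴ * M) * strangeProj * Mᴴ := by simp only [Matrix.mul_assoc]
    _ = _ := by rw [hU, mul_one, Matrix.mul_assoc M, strangeProj_mul_self]

theorem IsStrangeState.trace_mul_le {ρ σ : Matrix (ZMod 3) (ZMod 3) ℂ} (h : IsStrangeState ρ)
    (hσ : σ ∈ stabilizerStates (ZMod 3)) : (ρ * σ).trace ≤ 1 / 2 := by
  refine trace_mul_le_of_mem_stabilizerStates (fun T hT => ?_) hσ
  obtain ⟨U, hU, rfl⟩ := h
  -- Cyclicity of the trace moves the Clifford unitary of the strange state onto the stabilizer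
  -- state.
  refine le_of_eq_of_le ?_ (trace_strangeProj_mul_le (mul_mem (inv_mem hU) hT))
  have hinv : ((U⁻¹ : Matrix.unitaryGroup (ZMod 3) ℂ) : Matrix (ZMod 3) (ZMod 3) ℂ) =
    (U : Matrix (ZMod 3) (ZMod 3) ℂ)ᴴ := rfl
  rw [Matrix.UnitaryGroup.mul_val, hinv, Matrix.conjTranspose_mul,
    Matrix.conjTranspose_conjTranspose]
  change ((U : Matrix (ZMod 3) (ZMod 3) ℂ) * strangeProj * _ * _).trace = _
  rw [Matrix.mul_assoc, Matrix.mul_assoc, Matrix.trace_mul_comm]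
  simp only [Matrix.mul_assoc]

theorem IsQuantumRelativeEntropy.one_le_magicMonotone
    {𝔻 : ∀ (A : Type) [Fintype A], Matrix A A ℂ → Matrix A A ℂ → EReal}
    (h𝔻 : IsQuantumRelativeEntropy 𝔻) {ρ : Matrix (ZMod 3) (ZMod 3) ℂ} (h : IsStrangeState ρ) :
    1 ≤ magicMonotone 𝔻 (ZMod 3) ρ :=
  le_iInf₂ fun _ hσ => h𝔻.one_le h.isState h.mul_self (isState_of_mem_stabilizerStates hσ)
    (h.trace_mul_le hσ)

/-- The shear `(x, y) ↦ (x, y + c x)` of the labels of two qutrits. -/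
def shear (c : ZMod 3) : ZMod 3 × ZMod 3 ≃+ ZMod 3 × ZMod 3 where
  toFun x := (x.1, x.2 + c * x.1)
  invFun x := (x.1, x.2 - c * x.1)
  left_inv x := by simp
  right_inv x := by simp
  map_add' x y := by
    ext
    · rfl
    · simp only [Prod.snd_add, Prod.fst_add]
      ring

/-- The indicator function of the line `y = c x`. -/
def lineKet (c : ZMod 3) : ZMod 3 × ZMod 3 → ℂ := fun x => if x.2 = c * x.1 then 1 else 0

theorem star_lineKet (c : ZMod 3) : star (lineKet c) = lineKet c := by
  ext x
  rw [Pi.star_apply, lineKet]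
  split_ifs <;> simp

/-- A Fourier transform on the first qutrit turns `|0, 0⟩` into the uniform superposition of the
`|x, 0⟩`, and the shear carries it to the line. -/
theorem lineKet_mem_stabilizerStates (c : ZMod 3) :
    (3 : ℂ)⁻¹ • Matrix.vecMulVec (lineKet c) (lineKet c) ∈
      stabilizerStates (ZMod 3 × ZMod 3) := by
  obtain ⟨F, hF, hFe⟩ := exists_mem_cliffordGroup_fourierMatrix (ZMod.isPrimitive_stdAddChar 3)
  obtain ⟨K, hK, hKe⟩ := exists_mem_cliffordGroup_kronecker hF (one_mem (cliffordGroup (ZMod 3)))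
  obtain ⟨P, hP, hPe⟩ := exists_mem_cliffordGroup_automorphismMatrix (shear c)
  refine subset_convexHull _ _ ⟨P * K, mul_mem hP hK, ?_⟩
  have hcol : ∀ x, ((P * K : Matrix.unitaryGroup (ZMod 3 × ZMod 3) ℂ) :
      Matrix (ZMod 3 × ZMod 3) (ZMod 3 × ZMod 3) ℂ) x 0 =
      (Real.sqrt 3 : ℂ)⁻¹ * lineKet c x := by
    intro x
    have hx : (shear c).symm x = (x.1, x.2 - c * x.1) := rfl
    rw [Matrix.UnitaryGroup.mul_val, hPe, hKe, hFe, automorphismMatrix_mul_apply, hx,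
      show (0 : ZMod 3 × ZMod 3) = (0, 0) from rfl, Matrix.kronecker_apply]
    simp [fourierMatrix, lineKet, Matrix.one_apply, sub_eq_zero]
  rw [mul_single_mul_conjTranspose]
  ext x y
  have hy : star (lineKet c y) = lineKet c y := congrFun (star_lineKet c) y
  rw [Matrix.vecMulVec_apply, Pi.star_apply, hcol, hcol, star_mul', hy,
    ← starRingEnd_apply, map_inv₀, Complex.conj_ofReal, mul_mul_mul_comm, ← mul_inv,
    ← Complex.ofReal_mul, Real.mul_self_sqrt (by norm_num)]
  simp [Matrix.vecMulVec_apply]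

/-- The two lines meet only at the origin, where the indicators cancel; elsewhere the signs are
those of `|S⟩ ⊗ |S⟩`. -/
theorem lineKet_one_sub_lineKet_neg_one (x : ZMod 3 × ZMod 3) :
    lineKet 1 x - lineKet (-1) x = 2 * (strangeKet x.1 * strangeKet x.2) := by
  have h2 := inv_sqrt_two_mul_self
  obtain ⟨i, j⟩ := x
  rcases zmod_three_cases i with rfl | rfl | rfl <;>
  rcases zmod_three_cases j with rfl | rfl | rfl <;>
  simp only [strangeKet_zero, strangeKet_one, strangeKet_two, neg_mul, mul_neg, h2, zero_mul,
    mul_zero, neg_neg, neg_zero] <;>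
  simp +decide [lineKet]

/-- Three times the even mixture of the two line states dominates two strange states. -/
theorem posSemidef_lineKet_sub_strangeProj :
    ((3 : ℂ) • ((1 / 2 : ℝ) • ((3 : ℂ)⁻¹ • Matrix.vecMulVec (lineKet 1) (lineKet 1)) +
      (1 / 2 : ℝ) • ((3 : ℂ)⁻¹ • Matrix.vecMulVec (lineKet (-1)) (lineKet (-1)))) -
      strangeProj ⊗ₖ strangeProj).PosSemidef := by
  -- With `u`, `v` the line vectors, `(uuᴴ + vvᴴ) / 2` minus the projector on `(u - v) / 2` is the
  -- rank-one matrix of `(u + v) / 2`.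
  have h := Matrix.posSemidef_vecMulVec_self_star
    ((2 : ℂ)⁻¹ • (lineKet 1 + lineKet (-1)))
  convert h using 1
  rw [star_smul, star_add, star_lineKet, star_lineKet]
  ext x y
  have hx := lineKet_one_sub_lineKet_neg_one x
  have hy := lineKet_one_sub_lineKet_neg_one y
  have hS : (strangeProj ⊗ₖ strangeProj) x y =
      (strangeKet x.1 * strangeKet x.2) * (strangeKet y.1 * strangeKet y.2) := by
    simp only [Matrix.kroneckerMap_apply, strangeProj, Matrix.vecMulVec_apply, star_strangeKet]
    ring
  have hx' : strangeKet x.1 * strangeKet x.2 = 2⁻¹ * (lineKet 1 x - lineKet (-1) x) := by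
    rw [hx]
    ring
  have hy' : strangeKet y.1 * strangeKet y.2 = 2⁻¹ * (lineKet 1 y - lineKet (-1) y) := by
    rw [hy]
    ring
  rw [Matrix.sub_apply, hS, hx', hy']
  simp only [Matrix.smul_apply, Matrix.add_apply, Matrix.vecMulVec_apply, Pi.smul_apply,
    Pi.add_apply, smul_eq_mul, Complex.real_smul, star_inv₀, star_ofNat]
  push_cast
  ring

theorem convex_stabilizerStates {V : Type} [Fintype V] [DecidableEq V] [AddCommGroup V] :
    Convex ℝ (stabilizerStates V) :=
  convex_convexHull ℝ _

theorem mul_mem_stabilizerStates {V : Type} [Fintype V] [DecidableEq V] [AddCommGroup V]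
    {U : Matrix.unitaryGroup V ℂ} (hU : U ∈ cliffordGroup V) {σ : Matrix V V ℂ}
    (hσ : σ ∈ stabilizerStates V) :
    (U : Matrix V V ℂ) * σ * (U : Matrix V V ℂ)ᴴ ∈ stabilizerStates V := by
  have hconv : Convex ℝ {σ : Matrix V V ℂ |
      (U : Matrix V V ℂ) * σ * (U : Matrix V V ℂ)ᴴ ∈ stabilizerStates V} := by
    intro σ hσ τ hτ a b ha hb hab
    have := convex_stabilizerStates hσ hτ ha hb hab
    simpa only [Set.mem_ofPred_eq, Matrix.mul_add, Matrix.add_mul, Matrix.mul_smul,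
      Matrix.smul_mul] using this
  refine convexHull_min ?_ hconv hσ
  rintro _ ⟨T, hT, rfl⟩
  refine subset_convexHull _ _ ⟨U * T, mul_mem hU hT, ?_⟩
  rw [Matrix.UnitaryGroup.mul_val, Matrix.conjTranspose_mul]
  simp only [Matrix.mul_assoc]

/-- A pair of strange states is dominated by three times a stabilizer state. -/
theorem IsStrangeState.exists_stabilizerStates_dominating {ρ₁ ρ₂ : Matrix (ZMod 3) (ZMod 3) ℂ}
    (h₁ : IsStrangeState ρ₁) (h₂ : IsStrangeState ρ₂) :
    ∃ σ ∈ stabilizerStates (ZMod 3 × ZMod 3), ((3 : ℂ) • σ - ρ₁ ⊗ₖ ρ₂).PosSemidef := by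
  obtain ⟨U₁, hU₁, rfl⟩ := h₁
  obtain ⟨U₂, hU₂, rfl⟩ := h₂
  obtain ⟨T, hT, hTe⟩ := exists_mem_cliffordGroup_kronecker hU₁ hU₂
  have hmix := convex_stabilizerStates (lineKet_mem_stabilizerStates 1)
    (lineKet_mem_stabilizerStates (-1)) (show (0 : ℝ) ≤ 1 / 2 by norm_num)
    (show (0 : ℝ) ≤ 1 / 2 by norm_num) (by norm_num)
  refine ⟨_, mul_mem_stabilizerStates hT hmix, ?_⟩
  have h := posSemidef_lineKet_sub_strangeProj.mul_mul_conjTranspose_same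
    (T : Matrix (ZMod 3 × ZMod 3) (ZMod 3 × ZMod 3) ℂ)
  rw [Matrix.mul_sub, Matrix.sub_mul, Matrix.mul_smul, Matrix.smul_mul] at h
  have e : (T : Matrix (ZMod 3 × ZMod 3) (ZMod 3 × ZMod 3) ℂ) * (strangeProj ⊗ₖ strangeProj) *
      (T : Matrix (ZMod 3 × ZMod 3) (ZMod 3 × ZMod 3) ℂ)ᴴ =
      ((U₁ : Matrix (ZMod 3) (ZMod 3) ℂ) * strangeProj * (U₁ : Matrix (ZMod 3) (ZMod 3) ℂ)ᴴ) ⊗ₖ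
      ((U₂ : Matrix (ZMod 3) (ZMod 3) ℂ) * strangeProj * (U₂ : Matrix (ZMod 3) (ZMod 3) ℂ)ᴴ) := by
    rw [hTe, Matrix.conjTranspose_kronecker, ← Matrix.mul_kronecker_mul,
      ← Matrix.mul_kronecker_mul]
  rwa [e] at h

end Strange

end Magic

theorem mainTheorem12
    (𝔻 : ∀ (A : Type) [Fintype A], Matrix A A ℂ → Matrix A A ℂ → EReal)
    (h𝔻 : Magic.IsQuantumRelativeEntropy 𝔻)
    (ρ₁ ρ₂ : Matrix (ZMod 3) (ZMod 3) ℂ)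
    (hρ₁ : Magic.IsStrangeState ρ₁) (hρ₂ : Magic.IsStrangeState ρ₂) :
    Magic.magicMonotone 𝔻 (ZMod 3 × ZMod 3) (ρ₁ ⊗ₖ ρ₂) ≠
      Magic.magicMonotone 𝔻 (ZMod 3) ρ₁ + Magic.magicMonotone 𝔻 (ZMod 3) ρ₂ := by
  intro heq
  obtain ⟨σ, hσ, hdom⟩ := hρ₁.exists_stabilizerStates_dominating hρ₂
  have h5 := h𝔻.add_add_le_five (hρ₁.isState.kronecker hρ₂.isState)
    (Magic.isState_of_mem_stabilizerStates hσ) hdom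
  have h2 : (1 + 1 : EReal) ≤ 𝔻 (ZMod 3 × ZMod 3) (ρ₁ ⊗ₖ ρ₂) σ :=
    (add_le_add (h𝔻.one_le_magicMonotone hρ₁) (h𝔻.one_le_magicMonotone hρ₂)).trans
      (heq ▸ iInf₂_le σ hσ)
  -- Adding three copies of the bound avoids division in `EReal` and ends in `6 ≤ 5`.
  have h6 : (((1 + 1) + (1 + 1) + (1 + 1) : ℝ) : EReal) ≤ ((5 : ℝ) : EReal) :=
    (add_le_add (add_le_add h2 h2) h2).trans h5
  rw [EReal.coe_le_coe_iff] at h6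
  norm_num at h6
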